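/- Let $\mathcal H,\mathcal K$ be finite-dimensional complex Hilbert spaces and let $\mathcal A\subseteq B(\mathcal H)$, $\mathcal B\subseteq B(\mathcal K)$ be $C^*$-algebras containing the identity operators. Density operators in $\mathcal A$ are the elements $\sigma\ge 0$ of $\mathcal A$ with $\mathrm{Tr}\,\sigma=1$. For a linear map $T:\mathcal A\to\mathcal B$ let $T^*:\mathcal B\to\mathcal A$ be its adjoint for the Hilbert--Schmidt inner products $\langle a,b\rangle=\mathrm{Tr}\,a^*b$. A linear map $\Phi$ between such algebras is a unital Schwarz map if $\Phi(I)=I$ and $\Phi(a^*a)\ge\Phi(a)^*\Phi(a)$ for all $a$. If $T^*$ is a unital Schwarz map and $\mathcal S$ is a set of density operators in $\mathcal A$, then $T$ is called reversible for $\mathcal S$ if there is a linear map $S:\mathcal B\to\mathcal A$ such that $S^*$ is a unital Schwarz map and $S(T(\sigma))=\sigma$ for all $\sigma\in\mathcal S$. Let $\mathcal S$ be a set of density operators in $\mathcal A$ and $T:\mathcal A\to\mathcal B$ a linear map such that 1. $\mathcal S$ contains an element $\rho$ such that $\rho$ and $T(\rho)$ are invertible; 2. both $T^*$ and the map $T_\rho:\mathcal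 A\to\mathcal B$, $T_\rho(b)=T(\rho)^{-1/2}\,T(\rho^{1/2}b\rho^{1/2})\,T(\rho)^{-1/2}$, are unital Schwarz maps. Then $T$ is reversible for $\mathcal S$ if and only if $T$ is reversible for $$\tilde{\mathcal S}:=\bigcup_{s\in\mathbb R}\rho^{is}\mathcal S\rho^{-is}=\{\rho^{is}\sigma\rho^{-is}:\ \sigma\in\mathcal S,\ s\in\mathbb R\}.$$ -/

import Mathlib

noncomputable section

namespace QuantumReversibility

section Adjoint

/-- The adjoint of a linear map between finite dimensional complex vector spaces
with respect to explicitly given inner products. -/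
def coreAdjoint {V W : Type*} [AddCommGroup V] [Module ℂ V] [FiniteDimensional ℂ V]
    [AddCommGroup W] [Module ℂ W] [FiniteDimensional ℂ W]
    (cV : InnerProductSpace.Core ℂ V) (cW : InnerProductSpace.Core ℂ W)
    (T : V →ₗ[ℂ] W) : W →ₗ[ℂ] V :=
  letI : NormedAddCommGroup V := cV.toNormedAddCommGroup
  letI : InnerProductSpace ℂ V := InnerProductSpace.ofCore cV.toCore
  letI : NormedAddCommGroup W := cW.toNormedAddCommGroup
  letI : InnerProductSpace ℂ W := InnerProductSpace.ofCore cW.toCore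
  LinearMap.adjoint T

theorem coreAdjoint_inner {V W : Type*} [AddCommGroup V] [Module ℂ V] [FiniteDimensional ℂ V]
    [AddCommGroup W] [Module ℂ W] [FiniteDimensional ℂ W]
    (cV : InnerProductSpace.Core ℂ V) (cW : InnerProductSpace.Core ℂ W)
    (T : V →ₗ[ℂ] W) (w : W) (v : V) :
    cV.inner (coreAdjoint cV cW T w) v = cW.inner w (T v) := by
  let : NormedAddCommGroup V := cV.toNormedAddCommGroup
  let : InnerProductSpace ℂ V := InnerProductSpace.ofCore cV.toCore
  let : NormedAddCommGroup W := cW.toNormedAddCommGroup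
  let : InnerProductSpace ℂ W := InnerProductSpace.ofCore cW.toCore
  exact LinearMap.adjoint_inner_left T v w

end Adjoint

variable {H : Type*} [NormedAddCommGroup H] [InnerProductSpace ℂ H] [FiniteDimensional ℂ H]
  [CompleteSpace H]
variable {K : Type*} [NormedAddCommGroup K] [InnerProductSpace ℂ K] [FiniteDimensional ℂ K]
  [CompleteSpace K]

/-- The trace `Tr = Tr_H` on `B(H)`. -/
def tr (a : H →L[ℂ] H) : ℂ := LinearMap.trace ℂ H (a : H →ₗ[ℂ] H)

theorem tr_star (a : H →L[ℂ] H) : tr (star a) = star (tr a) := by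
  unfold tr
  rw [LinearMap.trace_eq_sum_inner _ (stdOrthonormalBasis ℂ H),
    LinearMap.trace_eq_sum_inner _ (stdOrthonormalBasis ℂ H), star_sum]
  refine Finset.sum_congr rfl fun i _ => ?_
  simp [ContinuousLinearMap.star_eq_adjoint, ContinuousLinearMap.adjoint_inner_right]

theorem tr_star_mul_self (a : H →L[ℂ] H) :
    tr (star a * a) = ∑ i, ((‖a (stdOrthonormalBasis ℂ H i)‖ ^ 2 : ℝ) : ℂ) := by
  unfold tr
  rw [LinearMap.trace_eq_sum_inner _ (stdOrthonormalBasis ℂ H)]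
  refine Finset.sum_congr rfl fun i _ => ?_
  simp [ContinuousLinearMap.star_eq_adjoint, ContinuousLinearMap.adjoint_inner_right,
    inner_self_eq_norm_sq_to_K]

theorem eq_zero_of_tr_star_mul_self (a : H →L[ℂ] H) (h : tr (star a * a) = 0) : a = 0 := by
  rw [tr_star_mul_self, ← Complex.ofReal_sum, Complex.ofReal_eq_zero,
    Finset.sum_eq_zero_iff_of_nonneg (fun i _ => by positivity)] at h
  have h' : (a : H →ₗ[ℂ] H) = 0 :=
    (stdOrthonormalBasis ℂ H).toBasis.ext fun i => by simpa using h i (Finset.mem_univ i)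
  ext x
  simpa using LinearMap.congr_fun h' x

/-- The Hilbert-Schmidt inner product `⟨a, b⟩ = Tr (a* b)` on a `*`-subalgebra of `B(H)`. -/
@[reducible] def hsCore (A : StarSubalgebra ℂ (H →L[ℂ] H)) : InnerProductSpace.Core ℂ A where
  inner a b := tr (star (a : H →L[ℂ] H) * (b : H →L[ℂ] H))
  conj_inner_symm a b := by
    rw [starRingEnd_apply, ← tr_star, star_mul, star_star]
  re_inner_nonneg a := by
    rw [tr_star_mul_self, ← Complex.ofReal_sum, RCLike.re_eq_complex_re, Complex.ofReal_re]
    exact Finset.sum_nonneg fun i _ => sq_nonneg _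
  add_left a b c := by simp [add_mul, tr]
  smul_left a b r := by simp [tr]
  definite a h := Subtype.ext (eq_zero_of_tr_star_mul_self _ h)

instance instFiniteDimensional (A : StarSubalgebra ℂ (H →L[ℂ] H)) : FiniteDimensional ℂ A :=
  inferInstanceAs (FiniteDimensional ℂ (Subalgebra.toSubmodule A.toSubalgebra))

theorem isClosed_coe (A : StarSubalgebra ℂ (H →L[ℂ] H)) : IsClosed (A : Set (H →L[ℂ] H)) :=
  Submodule.closed_of_finiteDimensional (Subalgebra.toSubmodule A.toSubalgebra)

/-- The adjoint `T*` of a linear map `T : A → B` with respect to the Hilbert-Schmidt inner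
products. -/
def hsAdjoint {A : StarSubalgebra ℂ (H →L[ℂ] H)} {B : StarSubalgebra ℂ (K →L[ℂ] K)}
    (T : A →ₗ[ℂ] B) : B →ₗ[ℂ] A :=
  coreAdjoint (hsCore A) (hsCore B) T

theorem hsAdjoint_spec {A : StarSubalgebra ℂ (H →L[ℂ] H)} {B : StarSubalgebra ℂ (K →L[ℂ] K)}
    (T : A →ₗ[ℂ] B) (b : B) (a : A) :
    tr (star (hsAdjoint T b : H →L[ℂ] H) * (a : H →L[ℂ] H)) =
      tr (star (b : K →L[ℂ] K) * (T a : K →L[ℂ] K)) :=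
  coreAdjoint_inner (hsCore A) (hsCore B) T b a

/-- Unital Schwarz maps: `Φ(1) = 1` and `Φ(a)* Φ(a) ≤ Φ(a* a)` for all `a`, in the Loewner
order of operators. -/
structure IsUnitalSchwarz {A : StarSubalgebra ℂ (H →L[ℂ] H)} {B : StarSubalgebra ℂ (K →L[ℂ] K)}
    (Φ : A →ₗ[ℂ] B) : Prop where
  map_one : Φ 1 = 1
  schwarz : ∀ a : A, ((star (Φ a) * Φ a : B) : K →L[ℂ] K) ≤ (Φ (star a * a) : K →L[ℂ] K)

/-- Density operators in `A`: positive elements with unit trace. -/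
def densities (A : StarSubalgebra ℂ (H →L[ℂ] H)) : Set A :=
  {a | 0 ≤ (a : H →L[ℂ] H) ∧ tr (a : H →L[ℂ] H) = 1}

/-- The real power `a ^ y` of `a ∈ A`, as an element of `A`. -/
def rpowIn {A : StarSubalgebra ℂ (H →L[ℂ] H)} (a : A) (y : ℝ) : A :=
  ⟨(a : H →L[ℂ] H) ^ y, by
    have := isClosed_coe A
    change cfc _ _ ∈ A
    by_cases ha : 0 ≤ (a : H →L[ℂ] H)
    · rw [cfc_nnreal_eq_real _ _ ha]
      exact cfc_mem (𝕜 := ℝ) (𝕜' := ℂ) _ a.2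
    · rw [cfc_apply_of_not_predicate _ ha]
      exact A.zero_mem⟩

/-- The imaginary power `a ^ (i s)`, as an element of `A`, for positive invertible `a ∈ A`
(where `x ^ (i s) = exp (i s log x)` on the spectrum of `a`). -/
def ipowIn {A : StarSubalgebra ℂ (H →L[ℂ] H)} (a : A) (s : ℝ) : A :=
  ⟨cfc (fun x : ℂ => x ^ (Complex.I * (s : ℂ))) (a : H →L[ℂ] H),
    have := isClosed_coe A
    cfc_mem (𝕜 := ℂ) (𝕜' := ℂ) _ a.2⟩

/-- The dual map `T_ρ(b) = T(ρ)^{-1/2} T(ρ^{1/2} b ρ^{1/2}) T(ρ)^{-1/2}`. -/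
def dualMap {A : StarSubalgebra ℂ (H →L[ℂ] H)} {B : StarSubalgebra ℂ (K →L[ℂ] K)}
    (T : A →ₗ[ℂ] B) (ρ : A) : A →ₗ[ℂ] B where
  toFun b := rpowIn (T ρ) (-(1 / 2)) * T (rpowIn ρ (1 / 2) * b * rpowIn ρ (1 / 2)) *
    rpowIn (T ρ) (-(1 / 2))
  map_add' b c := by simp only [mul_add, add_mul, map_add]
  map_smul' r b := by
    simp only [mul_smul_comm, smul_mul_assoc, map_smul, RingHom.id_apply]

/-- `T` is reversible for `S`: some linear `R : B → A` whose adjoint is a unital Schwarz map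
satisfies `R (T σ) = σ` for all `σ ∈ S`. -/
def IsReversible {A : StarSubalgebra ℂ (H →L[ℂ] H)} {B : StarSubalgebra ℂ (K →L[ℂ] K)}
    (T : A →ₗ[ℂ] B) (S : Set A) : Prop :=
  ∃ R : B →ₗ[ℂ] A, IsUnitalSchwarz (hsAdjoint R) ∧ ∀ σ ∈ S, R (T σ) = σ

/-- The modular orbit `⋃ₛ ρ^{is} S ρ^{-is}`. -/
def modularOrbit {A : StarSubalgebra ℂ (H →L[ℂ] H)} (ρ : A) (S : Set A) : Set A :=
  ⋃ s : ℝ, (fun σ : A => ipowIn ρ s * σ * ipowIn ρ (-s)) '' S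

end QuantumReversibility

end

set_option linter.unusedSectionVars false

noncomputable section

namespace QuantumReversibility

variable {H : Type*} [NormedAddCommGroup H] [InnerProductSpace ℂ H]

/-! The recovery map `R` for `S` already recovers the whole modular orbit. Put `M = R ∘ T`, with
Hilbert-Schmidt adjoint `L = T* R*`. As `M` fixes `ρ`, two Schwarz inequalities make `L` a
contraction for `⟨a, b⟩ = Tr (ρ a* b)` (`gnsForm_comp_le`). If `M τ = τ`, write `τ = a ρ`:
contractivity forces `L a = a`, hence `L a* = a*`, and a fixed vector of a contraction is also fixed
by its adjoint, which here says `M (ρ a) = ρ a` (`fixed_conj`). So the fixed points of `M` are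
stable under `τ ↦ ρ τ ρ⁻¹`. In finite dimension `τ ↦ ρ^{is} τ ρ^{-is}` is a polynomial in that map
(`exists_sum_conj_eq`), so they are stable under it too. The converse holds because `s = 0` gives
back `S`. -/

theorem tr_add (a b : H →L[ℂ] H) : tr (a + b) = tr a + tr b := by simp [tr]

theorem tr_sub (a b : H →L[ℂ] H) : tr (a - b) = tr a - tr b := by simp [tr]

theorem tr_smul (c : ℂ) (a : H →L[ℂ] H) : tr (c • a) = c * tr a := by simp [tr]

theorem tr_mul_comm (a b : H →L[ℂ] H) : tr (a * b) = tr (b * a) :=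
  LinearMap.trace_mul_comm ℂ (a : H →ₗ[ℂ] H) (b : H →ₗ[ℂ] H)

theorem aeval_apply_of_apply_eq {a : H →L[ℂ] H} {v : H} {μ : ℂ} (hv : a v = μ • v)
    (p : Polynomial ℂ) : Polynomial.aeval a p v = p.eval μ • v := by
  induction p using Polynomial.induction_on' with
  | add p q hp hq => simp [hp, hq, add_smul]
  | monomial n c =>
    have : (a ^ n) v = μ ^ n • v := by
      induction n with
      | zero => simp
      | succ n ih => rw [pow_succ', mul_apply_eq_comp, ih, map_smul, hv, smul_smul,
          pow_succ]
    simp [Polynomial.aeval_monomial, Polynomial.eval_monomial, this, smul_smul,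
      Algebra.algebraMap_eq_smul_one]

variable [FiniteDimensional ℂ H] [CompleteSpace H]
variable {K : Type*} [NormedAddCommGroup K] [InnerProductSpace ℂ K] [FiniteDimensional ℂ K]
  [CompleteSpace K]

/-! ### Trace positivity and Schwarz maps -/

theorem tr_star_mul_self_re_nonneg (a : H →L[ℂ] H) : 0 ≤ (tr (star a * a)).re := by
  rw [tr_star_mul_self, ← Complex.ofReal_sum, Complex.ofReal_re]
  exact Finset.sum_nonneg fun i _ => sq_nonneg _

theorem tr_star_mul_self_im (a : H →L[ℂ] H) : (tr (star a * a)).im = 0 := by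
  rw [tr_star_mul_self, ← Complex.ofReal_sum, Complex.ofReal_im]

/-- A positive operator has a self-adjoint square root in any `*`-subalgebra containing it. -/
theorem exists_sq_eq {A : StarSubalgebra ℂ (H →L[ℂ] H)} {a : A}
    (ha : 0 ≤ (a : H →L[ℂ] H)) : ∃ s : A, star s = s ∧ s * s = a := by
  refine ⟨rpowIn a (1 / 2), ?_, ?_⟩
  · apply Subtype.ext
    exact (IsSelfAdjoint.of_nonneg (CFC.rpow_nonneg (a := (a : H →L[ℂ] H)) (y := 1 / 2))).star_eq
  · apply Subtype.ext
    change (a : H →L[ℂ] H) ^ (1 / 2 : ℝ) * (a : H →L[ℂ] H) ^ (1 / 2 : ℝ) = a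
    rw [← CFC.sqrt_eq_rpow, CFC.sqrt_mul_sqrt_self _ ha]

theorem tr_mul_re_nonneg {a b : H →L[ℂ] H} (ha : 0 ≤ a) (hb : 0 ≤ b) :
    0 ≤ (tr (a * b)).re := by
  obtain ⟨s, hs, rfl⟩ := CStarAlgebra.nonneg_iff_eq_star_mul_self.mp ha |>.imp
    fun s hs => And.intro trivial hs
  have : tr (star s * s * b) = tr (s * b * star s) := by rw [mul_assoc, tr_mul_comm]
  obtain ⟨r, rfl⟩ := CStarAlgebra.nonneg_iff_eq_star_mul_self.mp hb
  rw [this]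
  have h := tr_star_mul_self_re_nonneg (r * star s)
  simpa [mul_assoc] using h

/-- The Schwarz defect at `z • 1 + x` is self-adjoint, and unitality reduces it to `z • D` plus a
constant, where `D = Φ(x*) - Φ(x)*`. Taking `z = 0, 1, i` forces `D = 0`. -/
theorem IsUnitalSchwarz.map_star {A : StarSubalgebra ℂ (H →L[ℂ] H)}
    {B : StarSubalgebra ℂ (K →L[ℂ] K)} {Φ : A →ₗ[ℂ] B} (h : IsUnitalSchwarz Φ) (x : A) :
    Φ (star x) = star (Φ x) := by
  have key : ∀ z : ℂ, star (Φ (star (z • 1 + x) * (z • 1 + x)) -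
      star (Φ (z • 1 + x)) * Φ (z • 1 + x)) = Φ (star (z • 1 + x) * (z • 1 + x)) -
      star (Φ (z • 1 + x)) * Φ (z • 1 + x) := fun z =>
    Subtype.ext (IsSelfAdjoint.of_nonneg (sub_nonneg.mpr (h.schwarz (z • 1 + x)))).star_eq
  have e : ∀ z : ℂ, Φ (star (z • 1 + x) * (z • 1 + x)) -
      star (Φ (z • 1 + x)) * Φ (z • 1 + x) =
      z • (Φ (star x) - star (Φ x)) + (Φ (star x * x) - star (Φ x) * Φ x) := fun z => by
    simp only [star_add, star_smul, star_one, add_mul, mul_add, smul_mul_assoc, mul_smul_comm,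
      one_mul, mul_one, map_add, map_smul, h.map_one, smul_sub, smul_add]
    abel
  have key' : ∀ z : ℂ, star z • star (Φ (star x) - star (Φ x)) +
      star (Φ (star x * x) - star (Φ x) * Φ x) =
      z • (Φ (star x) - star (Φ x)) + (Φ (star x * x) - star (Φ x) * Φ x) := fun z => by
    rw [← star_smul, ← star_add, ← e, key]
  clear key
  have k0 := key' 0
  simp only [star_zero, zero_smul, zero_add] at k0
  simp only [k0, add_left_inj] at key'
  have k1 := key' 1
  have kI := key' Complex.I
  simp only [star_one, one_smul] at k1
  rw [k1, ← sub_eq_zero, ← sub_smul, smul_eq_zero] at kI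
  rcases kI with kI | kI
  · have := congrArg Complex.im kI
    norm_num at this
  · exact sub_eq_zero.mp kI

theorem tr_hsAdjoint_mul {A : StarSubalgebra ℂ (H →L[ℂ] H)}
    {B : StarSubalgebra ℂ (K →L[ℂ] K)} {T : A →ₗ[ℂ] B} (h : IsUnitalSchwarz (hsAdjoint T))
    (b : B) (a : A) :
    tr ((hsAdjoint T b * a : A) : H →L[ℂ] H) = tr ((b * T a : B) : K →L[ℂ] K) := by
  have := hsAdjoint_spec T (star b) a
  rw [h.map_star] at this
  simpa using this

/-! ### The GNS form of `ρ` and its contractions -/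

section GNS

variable {A : StarSubalgebra ℂ (H →L[ℂ] H)}

/-- The form `⟨a, b⟩ = Tr (ρ a* b)`. -/
def gnsForm (ρ a b : A) : ℂ := tr ((ρ * (star a * b) : A) : H →L[ℂ] H)

theorem gnsForm_add_left (ρ a b c : A) : gnsForm ρ (a + b) c = gnsForm ρ a c + gnsForm ρ b c := by
  simp [gnsForm, add_mul, mul_add, tr_add]

theorem gnsForm_add_right (ρ a b c : A) :
    gnsForm ρ a (b + c) = gnsForm ρ a b + gnsForm ρ a c := by
  simp [gnsForm, mul_add, tr_add]

theorem gnsForm_sub_left (ρ a b c : A) : gnsForm ρ (a - b) c = gnsForm ρ a c - gnsForm ρ b c := by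
  simp [gnsForm, sub_mul, mul_sub, tr_sub]

theorem gnsForm_sub_right (ρ a b c : A) :
    gnsForm ρ a (b - c) = gnsForm ρ a b - gnsForm ρ a c := by
  simp [gnsForm, mul_sub, tr_sub]

theorem gnsForm_smul_left (ρ a b : A) (z : ℂ) : gnsForm ρ (z • a) b = star z * gnsForm ρ a b := by
  simp [gnsForm, tr_smul]

theorem gnsForm_smul_right (ρ a b : A) (z : ℂ) : gnsForm ρ a (z • b) = z * gnsForm ρ a b := by
  simp [gnsForm, tr_smul]

theorem star_gnsForm {ρ : A} (hρ : star ρ = ρ) (a b : A) :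
    star (gnsForm ρ a b) = gnsForm ρ b a := by
  rw [gnsForm, gnsForm, ← tr_star]
  have : star (ρ * (star a * b)) = (star b * a) * ρ := by simp [hρ]
  calc _ = tr ((star (ρ * (star a * b)) : A) : H →L[ℂ] H) := rfl
    _ = _ := by rw [this]; exact tr_mul_comm _ _

/-- With `ρ = s²`, the form at `a` is the squared Hilbert-Schmidt norm of `a s`. -/
theorem eq_zero_of_gnsForm_self {ρ : A} (hρ : 0 ≤ (ρ : H →L[ℂ] H)) (hu : IsUnit ρ) {a : A}
    (h : (gnsForm ρ a a).re ≤ 0) : a = 0 := by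
  obtain ⟨s, hs, rfl⟩ := exists_sq_eq hρ
  have e : gnsForm (s * s) a a =
      tr (star ((a * s : A) : H →L[ℂ] H) * ((a * s : A) : H →L[ℂ] H)) := by
    calc _ = tr ((s * (s * (star a * a)) : A) : H →L[ℂ] H) := by rw [gnsForm, mul_assoc]
      _ = tr (((s * (star a * a)) * s : A) : H →L[ℂ] H) := tr_mul_comm _ _
      _ = tr ((star (a * s) * (a * s) : A) : H →L[ℂ] H) := by simp [hs, mul_assoc]
  rw [e] at h
  have h0 : a * s = 0 := Subtype.ext <| eq_zero_of_tr_star_mul_self _ <|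
    Complex.ext (le_antisymm h (tr_star_mul_self_re_nonneg _)) (tr_star_mul_self_im _)
  have h1 : a * (s * s) = 0 := by rw [← mul_assoc, h0, zero_mul]
  exact (hu.mul_left_eq_zero).mp h1

variable {ρ : A} {L M : A →ₗ[ℂ] A}

/-- Fixed vectors of a contraction are orthogonal to the range of `1 - L`. -/
theorem gnsForm_map_sub_eq_zero (hρ : star ρ = ρ)
    (hc : ∀ a, (gnsForm ρ (L a) (L a)).re ≤ (gnsForm ρ a a).re) {a : A} (ha : L a = a) (x : A) :
    gnsForm ρ a (L x - x) = 0 := by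
  set z := gnsForm ρ a (L x - x) with hz
  have expand : ∀ (t : ℂ) (y : A), (gnsForm ρ (a + t • y) (a + t • y)).re =
      (gnsForm ρ a a).re + 2 * (t * gnsForm ρ a y).re +
        Complex.normSq t * (gnsForm ρ y y).re := fun t y => by
    rw [gnsForm_add_left, gnsForm_add_right, gnsForm_add_right, gnsForm_smul_left,
      gnsForm_smul_left, gnsForm_smul_right, gnsForm_smul_right, ← star_gnsForm hρ a y]
    simp [Complex.normSq_apply]
    ring
  -- Contractivity at `a + ε z̄ x`: the gain is first order in `ε`, the available slack second
  -- order.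
  have main : ∀ ε : ℝ, 0 < ε → 2 * Complex.normSq z ≤
      ε * (Complex.normSq z * ((gnsForm ρ x x).re - (gnsForm ρ (L x) (L x)).re)) := fun ε hε => by
    have h := hc (a + ((ε : ℂ) * star z) • x)
    rw [map_add, map_smul, ha, expand, expand] at h
    have e : ((ε : ℂ) * star z * gnsForm ρ a (L x)).re - ((ε : ℂ) * star z * gnsForm ρ a x).re =
        ε * Complex.normSq z := by
      rw [← Complex.sub_re, ← mul_sub, ← gnsForm_sub_right, ← hz]
      simp [Complex.normSq_apply]
      ring
    have n : Complex.normSq ((ε : ℂ) * star z) = ε * ε * Complex.normSq z := by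
      simp [Complex.normSq_apply]
      ring
    rw [n] at h
    have : ε * (2 * Complex.normSq z) ≤ ε *
      (ε * (Complex.normSq z * ((gnsForm ρ x x).re - (gnsForm ρ (L x) (L x)).re))) := by
      linear_combination h - 2 * e
    exact le_of_mul_le_mul_left this hε
  set C := Complex.normSq z * ((gnsForm ρ x x).re - (gnsForm ρ (L x) (L x)).re)
  have : 2 * Complex.normSq z ≤ 0 := by
    refine ge_of_tendsto (f := fun ε : ℝ => ε * C) (x := nhdsWithin 0 (Set.Ioi 0)) ?_
      (Filter.eventually_of_mem (U := Set.Ioi 0) self_mem_nhdsWithin fun ε hε => main ε hε)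
    have : Filter.Tendsto (fun ε : ℝ => ε * C) (nhds 0) (nhds (0 * C)) :=
      (continuous_id.mul continuous_const).tendsto 0
    rw [zero_mul] at this
    exact this.mono_left nhdsWithin_le_nhds
  exact Complex.normSq_eq_zero.mp (le_antisymm (by linarith) (Complex.normSq_nonneg z))

/-- The fixed points of the predual of a contraction are stable under `τ ↦ ρ τ ρ⁻¹`. -/
theorem fixed_conj (hρ : 0 ≤ (ρ : H →L[ℂ] H)) {u : A} (hu : ρ * u = 1) (hu' : u * ρ = 1)
    (hL : ∀ x, L (star x) = star (L x))
    (hLM : ∀ x a, tr ((L x * a : A) : H →L[ℂ] H) = tr ((x * M a : A) : H →L[ℂ] H))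
    (hc : ∀ a, (gnsForm ρ (L a) (L a)).re ≤ (gnsForm ρ a a).re) {τ : A} (hτ : M τ = τ) :
    M (ρ * τ * u) = ρ * τ * u := by
  have hs : star ρ = ρ := Subtype.ext (IsSelfAdjoint.of_nonneg hρ).star_eq
  have hunit : IsUnit ρ := ⟨⟨ρ, u, hu, hu'⟩, rfl⟩
  obtain ⟨a, rfl⟩ : ∃ a, τ = a * ρ := ⟨τ * u, by rw [mul_assoc, hu', mul_one]⟩
  have form : ∀ x y : A, gnsForm ρ x y = tr ((star x * (y * ρ) : A) : H →L[ℂ] H) := fun x y => by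
    rw [← mul_assoc]
    exact tr_mul_comm _ _
  have e1 : gnsForm ρ (L a) a = gnsForm ρ a a := by
    rw [form, form, ← hL, hLM, hτ]
  have e2 : gnsForm ρ a (L a) = gnsForm ρ a a := by
    rw [← star_gnsForm hs, e1, star_gnsForm hs]
  -- `‖L a - a‖² = ‖L a‖² - ‖a‖² ≤ 0`, since both cross terms equal `‖a‖²`.
  have ha : L a = a := by
    refine sub_eq_zero.mp (eq_zero_of_gnsForm_self hρ hunit ?_)
    rw [gnsForm_sub_left, gnsForm_sub_right, gnsForm_sub_right, e1, e2]
    simpa using hc a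
  have ha' : L (star a) = star a := by rw [hL, ha]
  -- Orthogonality of `a*` to `L x - x` reads `Tr (ρ a (L x - x)) = 0`; duality moves `L` onto `ρ a`
  -- as `M`.
  have orth : ∀ x : A, tr ((x * (M (ρ * a) - ρ * a) : A) : H →L[ℂ] H) = 0 := fun x => by
    have h := gnsForm_map_sub_eq_zero hs hc ha' x
    have h1 : tr (((L x - x) * (ρ * a) : A) : H →L[ℂ] H) = 0 := by
      rw [← h, gnsForm, star_star, ← mul_assoc]
      exact tr_mul_comm ((L x - x : A) : H →L[ℂ] H) ((ρ * a : A) : H →L[ℂ] H)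
    rw [sub_mul] at h1
    rw [mul_sub]
    have h2 := hLM x (ρ * a)
    rw [AddSubgroupClass.coe_sub, tr_sub] at h1 ⊢
    rw [← h2, h1]
  have : ρ * (a * ρ) * u = ρ * a := by
    rw [mul_assoc, mul_assoc a, hu, mul_one]
  rw [this]
  have h0 : ((M (ρ * a) - ρ * a : A) : H →L[ℂ] H) = 0 :=
    eq_zero_of_tr_star_mul_self _ (orth (star (M (ρ * a) - ρ * a)))
  exact sub_eq_zero.mp (Subtype.ext h0)

end GNS

/-- Each Schwarz inequality is paired with a state: that of `T*` with `ρ`, that of `R*` with `T ρ`;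
then `R (T ρ) = ρ` closes the chain. -/
theorem gnsForm_comp_le {A : StarSubalgebra ℂ (H →L[ℂ] H)} {B : StarSubalgebra ℂ (K →L[ℂ] K)}
    {T : A →ₗ[ℂ] B} {R : B →ₗ[ℂ] A} (hT : IsUnitalSchwarz (hsAdjoint T))
    (hR : IsUnitalSchwarz (hsAdjoint R)) {ρ : A} (hρ : 0 ≤ (ρ : H →L[ℂ] H)) (h : R (T ρ) = ρ)
    (a : A) :
    (gnsForm ρ (hsAdjoint T (hsAdjoint R a)) (hsAdjoint T (hsAdjoint R a))).re ≤
      (gnsForm ρ a a).re := by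
  have step : ∀ b : B, (gnsForm ρ (hsAdjoint T b) (hsAdjoint T b)).re ≤
      (tr ((star b * b * T ρ : B) : K →L[ℂ] K)).re := fun b => by
    have h1 := tr_mul_re_nonneg hρ (sub_nonneg.mpr (hT.schwarz b))
    rw [mul_sub, tr_sub, Complex.sub_re, sub_nonneg] at h1
    refine h1.trans (le_of_eq ?_)
    rw [← tr_hsAdjoint_mul hT, tr_mul_comm]
    rfl
  refine (step _).trans ?_
  have pos := sub_nonneg.mpr (hR.schwarz a)
  obtain ⟨s, hs, hss⟩ := exists_sq_eq (a := hsAdjoint R (star a * a) -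
    star (hsAdjoint R a) * hsAdjoint R a) pos
  -- Positivity of `T ρ` as a functional on squares comes from `step` and `ρ ≥ 0`.
  have h2 : 0 ≤ (tr ((star s * s * T ρ : B) : K →L[ℂ] K)).re := by
    refine le_trans ?_ (step s)
    have := tr_mul_re_nonneg hρ (star_mul_self_nonneg ((hsAdjoint T s : A) : H →L[ℂ] H))
    exact this
  rw [hs, hss, sub_mul, AddSubgroupClass.coe_sub, tr_sub, Complex.sub_re, sub_nonneg,
    tr_hsAdjoint_mul hR, h] at h2
  refine h2.trans (le_of_eq ?_)
  rw [gnsForm]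
  exact congrArg Complex.re (tr_mul_comm _ _)

/-! ### Imaginary powers as polynomials in conjugation -/

section Powers

theorem cfc_eq_aeval {a : H →L[ℂ] H} (ha : IsStarNormal a) (f : ℂ → ℂ) {p : Polynomial ℂ}
    (h : ∀ x ∈ spectrum ℂ a, f x = p.eval x) : cfc f a = Polynomial.aeval a p := by
  rw [cfc_congr (g := p.eval) h, cfc_polynomial p a]

theorem exists_polynomial_eval_eq {s : Set ℂ} (hs : s.Finite) (f : ℂ → ℂ) :
    ∃ p : Polynomial ℂ, ∀ x ∈ s, p.eval x = f x :=
  ⟨Lagrange.interpolate hs.toFinset id f, fun _ hx =>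
    Lagrange.eval_interpolate_at_node f (Set.injOn_id _) (hs.mem_toFinset.mpr hx)⟩

theorem finite_spectrum (a : H →L[ℂ] H) : (spectrum ℂ a).Finite := by
  have : spectrum ℂ a = spectrum ℂ (a : H →ₗ[ℂ] H) := by
    ext μ
    rw [spectrum.mem_iff, spectrum.mem_iff, not_iff_not, ContinuousLinearMap.isUnit_iff_bijective,
      Module.End.isUnit_iff]
    rfl
  rw [this]
  exact Module.End.finite_spectrum _

theorem cfc_apply_of_apply_eq {a : H →L[ℂ] H} (ha : IsStarNormal a) (f : ℂ → ℂ) {v : H} {μ : ℂ}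
    (hμ : μ ∈ spectrum ℂ a) (hv : a v = μ • v) : cfc f a v = f μ • v := by
  obtain ⟨p, hp⟩ := exists_polynomial_eval_eq (finite_spectrum a) f
  rw [cfc_eq_aeval ha f fun x hx => (hp x hx).symm, aeval_apply_of_apply_eq hv, hp μ hμ]

theorem mem_spectrum_of_apply_eq {a : H →L[ℂ] H} {v : H} {μ : ℂ} (hv : a v = μ • v)
    (h0 : v ≠ 0) : μ ∈ spectrum ℂ a := by
  rw [spectrum.mem_iff, ContinuousLinearMap.isUnit_iff_bijective]
  intro h
  refine h0 (h.1 ?_)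
  simp [hv, Algebra.algebraMap_eq_smul_one]

/-- `x ↦ a^{is} x a^{-is}` is a polynomial in `x ↦ a x a⁻¹`. -/
theorem exists_sum_conj_eq {a b : H →L[ℂ] H} (ha : 0 ≤ a) (hba : b * a = 1)
    (s : ℝ) : ∃ p : Polynomial ℂ, ∀ x : H →L[ℂ] H,
      cfc (fun z : ℂ => z ^ (Complex.I * (s : ℂ))) a * x *
        cfc (fun z : ℂ => z ^ (Complex.I * ((-s : ℝ) : ℂ))) a =
      p.sum fun n c => c • (a ^ n * x * b ^ n) := by
  have hpos : a.IsPositive := (ContinuousLinearMap.nonneg_iff_isPositive a).mp ha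
  have hn : IsStarNormal a := (IsSelfAdjoint.of_nonneg ha).isStarNormal
  have hsymm : (a : H →ₗ[ℂ] H).IsSymmetric := hpos.isSymmetric
  set e := hsymm.eigenvectorBasis rfl with he
  set l := hsymm.eigenvalues rfl with hl
  have hae : ∀ i, a (e i) = (l i : ℂ) • e i := fun i => hsymm.apply_eigenvectorBasis rfl i
  have hsp : ∀ i, (l i : ℂ) ∈ spectrum ℂ a := fun i =>
    mem_spectrum_of_apply_eq (hae i) (e.orthonormal.ne_zero i)
  have hl0 : ∀ i, 0 < l i := fun i => by
    refine lt_of_le_of_ne ?_ fun h => ?_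
    · have := hpos.re_inner_nonneg_left (e i)
      rw [hae, inner_smul_left, inner_self_eq_norm_sq_to_K, e.orthonormal.1 i] at this
      simpa using this
    · have h1 : b (a (e i)) = e i := by
        rw [← mul_apply_eq_comp, hba]; rfl
      rw [hae, ← h] at h1
      exact e.orthonormal.ne_zero i (by simpa using h1.symm)
  have hbe : ∀ i, b (e i) = ((l i : ℂ)⁻¹) • e i := fun i => by
    have h1 : b (a (e i)) = e i := by
      rw [← mul_apply_eq_comp, hba]; rfl
    rw [hae, map_smul] at h1
    rw [← h1, smul_smul, h1, inv_mul_cancel₀, one_smul]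
    exact_mod_cast (hl0 i).ne'
  -- Conjugation by `a` scales the `(i, j)` matrix entry by `l i / l j`, so `z ^ (is)` is
  -- interpolated at these finitely many ratios.
  obtain ⟨p, hp⟩ := exists_polynomial_eval_eq
    (Set.finite_range fun ij : _ × _ => (l ij.1 : ℂ) * (l ij.2 : ℂ)⁻¹)
    (fun z : ℂ => z ^ (Complex.I * (s : ℂ)))
  refine ⟨p, fun x => ?_⟩
  have hpow : ∀ {c : H →L[ℂ] H} {v : H} {μ : ℂ}, c v = μ • v → ∀ n : ℕ, (c ^ n) v = μ ^ n • v :=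
    fun hv n => by simpa using aeval_apply_of_apply_eq hv (Polynomial.X ^ n)
  -- On `e j` the right-hand factors act as scalars, which leaves an identity between functions of
  -- `a` alone.
  have hleft : ∀ j, (l j : ℂ) ^ (Complex.I * ((-s : ℝ) : ℂ)) •
      cfc (fun z : ℂ => z ^ (Complex.I * (s : ℂ))) a =
      p.sum fun n c => (c * (l j : ℂ)⁻¹ ^ n) • a ^ n := fun j => by
    refine ContinuousLinearMap.coe_injective (e.toBasis.ext fun i => ?_)
    have h := hp _ ⟨(i, j), rfl⟩
    simp only [Polynomial.eval_eq_sum] at h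
    simp only [OrthonormalBasis.coe_toBasis, ContinuousLinearMap.coe_coe, Polynomial.sum,
      sum_apply, smul_apply,
      cfc_apply_of_apply_eq hn _ (hsp i) (hae i), hpow (hae i), smul_smul, ← Finset.sum_smul]
    congr 1
    have h2 : ((l i : ℂ) * (l j : ℂ)⁻¹) ^ (Complex.I * (s : ℂ)) =
        (l j : ℂ) ^ (Complex.I * ((-s : ℝ) : ℂ)) * (l i : ℂ) ^ (Complex.I * (s : ℂ)) := by
      rw [← Complex.ofReal_inv, Complex.mul_cpow_ofReal_nonneg (hl0 i).le (inv_pos.mpr (hl0 j)).le,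
        mul_comm, Complex.ofReal_inv, Complex.inv_cpow, Complex.ofReal_neg, mul_neg,
        Complex.cpow_neg]
      rw [Complex.arg_ofReal_of_nonneg (hl0 j).le]
      exact Real.pi_pos.ne
    rw [← h2, ← h, Polynomial.sum]
    refine Finset.sum_congr rfl fun n _ => ?_
    rw [mul_pow]
    ring
  refine ContinuousLinearMap.coe_injective (e.toBasis.ext fun j => ?_)
  have h := DFunLike.congr_fun (hleft j) (x (e j))
  simp only [smul_apply, Polynomial.sum, sum_apply] at h
  simp only [OrthonormalBasis.coe_toBasis, ContinuousLinearMap.coe_coe, Polynomial.sum,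
    sum_apply, smul_apply, mul_apply_eq_comp,
    cfc_apply_of_apply_eq hn _ (hsp j) (hae j), hpow (hbe j), map_smul, smul_smul, h]

end Powers

theorem ipowIn_zero {A : StarSubalgebra ℂ (H →L[ℂ] H)} {a : A} (ha : IsStarNormal (a : H →L[ℂ] H)) :
    ipowIn a 0 = 1 := by
  apply Subtype.ext
  simp only [ipowIn, Complex.ofReal_zero, mul_zero, Complex.cpow_zero]
  exact cfc_const_one ℂ (a : H →L[ℂ] H)

/-- The fixed points of a linear map are stable under the modular group of `ρ` as soon as they
are stable under `τ ↦ ρ τ ρ⁻¹`. -/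
theorem map_ipowIn_conj {A : StarSubalgebra ℂ (H →L[ℂ] H)} {ρ u : A}
    (hρ : 0 ≤ (ρ : H →L[ℂ] H)) (hu' : u * ρ = 1) {M : A →ₗ[ℂ] A}
    (hM : ∀ τ, M τ = τ → M (ρ * τ * u) = ρ * τ * u) {τ : A} (hτ : M τ = τ) (s : ℝ) :
    M (ipowIn ρ s * τ * ipowIn ρ (-s)) = ipowIn ρ s * τ * ipowIn ρ (-s) := by
  have hpow : ∀ n : ℕ, M (ρ ^ n * τ * u ^ n) = ρ ^ n * τ * u ^ n := fun n => by
    induction n with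
    | zero => simpa using hτ
    | succ n ih =>
      have := hM _ ih
      have e : ρ ^ (n + 1) * τ * u ^ (n + 1) = ρ * (ρ ^ n * τ * u ^ n) * u := by
        rw [pow_succ', pow_succ]
        simp only [mul_assoc]
      rw [e, this]
  obtain ⟨p, hp⟩ := exists_sum_conj_eq hρ (b := (u : H →L[ℂ] H)) (congrArg Subtype.val hu') s
  have e : ipowIn ρ s * τ * ipowIn ρ (-s) = p.sum fun n c => c • (ρ ^ n * τ * u ^ n) := by
    apply Subtype.ext
    refine (hp (τ : H →L[ℂ] H)).trans ?_
    simp [Polynomial.sum]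
  rw [e, Polynomial.sum, map_sum]
  exact Finset.sum_congr rfl fun n _ => by rw [map_smul, hpow]

end QuantumReversibility

end

/-! ### The equivalence -/

open QuantumReversibility in
theorem corollary1
    {H : Type*} [NormedAddCommGroup H] [InnerProductSpace ℂ H] [FiniteDimensional ℂ H]
    [CompleteSpace H]
    {K : Type*} [NormedAddCommGroup K] [InnerProductSpace ℂ K] [FiniteDimensional ℂ K]
    [CompleteSpace K]
    (A : StarSubalgebra ℂ (H →L[ℂ] H)) (B : StarSubalgebra ℂ (K →L[ℂ] K))
    (S : Set A) (hS : S ⊆ QuantumReversibility.densities A)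
    (T : A →ₗ[ℂ] B) (ρ : A)
    (hρS : ρ ∈ S) (hρ : IsUnit ρ) (hTρ : IsUnit (T ρ))
    (hT : QuantumReversibility.IsUnitalSchwarz (QuantumReversibility.hsAdjoint T))
    (hTd : QuantumReversibility.IsUnitalSchwarz (QuantumReversibility.dualMap T ρ)) :
    QuantumReversibility.IsReversible T S ↔
      QuantumReversibility.IsReversible T (QuantumReversibility.modularOrbit ρ S) := by
  have hpos : 0 ≤ (ρ : H →L[ℂ] H) := (hS hρS).1
  constructor
  · rintro ⟨R, hR, hfix⟩
    refine ⟨R, hR, fun σ hσ => ?_⟩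
    obtain ⟨s, τ, hτ, rfl⟩ := Set.mem_iUnion.mp hσ
    obtain ⟨⟨ρ, u, hu, hu'⟩, rfl⟩ := hρ
    refine map_ipowIn_conj (M := R ∘ₗ T) hpos hu' (fun τ hτ => ?_) (hfix τ hτ) s
    refine fixed_conj (L := hsAdjoint T ∘ₗ hsAdjoint R) hpos hu hu' (fun x => ?_) (fun x a => ?_)
      (gnsForm_comp_le hT hR hpos (hfix _ hρS)) hτ
    · simp only [LinearMap.comp_apply, hR.map_star, hT.map_star]
    · simp only [LinearMap.comp_apply]
      rw [tr_hsAdjoint_mul hT, tr_hsAdjoint_mul hR]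
  · rintro ⟨R, hR, hfix⟩
    refine ⟨R, hR, fun σ hσ => hfix σ (Set.mem_iUnion.mpr ⟨0, σ, hσ, ?_⟩)⟩
    have hn : IsStarNormal (ρ : H →L[ℂ] H) := (IsSelfAdjoint.of_nonneg hpos).isStarNormal
    simp only [neg_zero, ipowIn_zero hn, one_mul, mul_one]
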